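/- **Corollary 3.5 (Lie group dimension).** Let $\mathbb{F}$ be $\mathbb{R}$ or $\mathbb{C}$, and let $V_0 \xrightarrow{f_1} V_1 \xrightarrow{f_2} \cdots \xrightarrow{f_\ell} V_\ell$ be a persistence module, that is, a sequence of finite-dimensional $\mathbb{F}$-vector spaces and $\mathbb{F}$-linear maps. Put $n_i = \dim V_i$, choose an arbitrary ordered basis of each $V_i$, and let $A_i \in \mathrm{Mat}(n_i \times n_{i-1};\mathbb{F})$ be the matrix of $f_i$ in these bases. Let $$\mathrm{Stab}(A_\bullet) = \Big\{ g = (g_0,\ldots,g_\ell) \in \prod_{i=0}^{\ell} \mathrm{GL}(n_i;\mathbb{F}) \;\Big|\; g_i A_i g_{i-1}^{-1} = A_i \text{ for all } 1 \le i \le \ell \Big\}.$$ For $0 \le i \le j \le \ell$, let $\mathbf{I}[i,j]$ be the interval module, with $\mathbb{F}$ at the positions $i,\ldots,j$, zero at all other positions, and identity maps between consecutive copies of $\mathbb{F}$. Let $d_{ij} \ge 0$ be the multiplicity of $[i,j]$ in the barcode of $(V_\bullet,f_\bullet)$, that is, $(V_\bullet,f_\bullet) \cong \bigoplus_{0 \le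 i \le j \le \ell} \mathbf{I}[i,j]^{d_{ij}}$ (such a decomposition exists). Write $[i_1,j_1] \preceq [i_2,j_2]$ if $i_1 \le i_2 \le j_1 \le j_2$. Then $\mathrm{Stab}(A_\bullet)$, with the topology and smooth structure of an embedded (over $\mathbb{F}$ analytic) submanifold of $\prod_{i} \mathrm{Mat}(n_i \times n_i;\mathbb{F})$ (in which $\prod_i \mathrm{GL}(n_i;\mathbb{F})$ is open), is a Lie group over $\mathbb{F}$ of dimension (over $\mathbb{F}$) $$\sum_{[i_1,j_1] \preceq [i_2,j_2]} d_{i_1 j_1}\, d_{i_2 j_2},$$ where the sum runs over all pairs of intervals in $[0,\ell]$ that satisfy the relation, including the pairs with $[i_1,j_1] = [i_2,j_2]$. -/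

import Mathlib

open scoped Manifold ContDiff

universe u v w

/-- A persistence module of length `ℓ + 1` over the field `𝕜`: finite-dimensional vector spaces
`V 0, …, V ℓ` with linear maps between consecutive ones. The map `V (i-1) → V i` is
indexed here by `i - 1 : Fin ℓ`. -/
structure PersistenceModule (𝕜 : Type u) [Field 𝕜] (ℓ : ℕ) where
  V : Fin (ℓ + 1) → Type v
  [instAddCommGroup : ∀ i, AddCommGroup (V i)]
  [instModule : ∀ i, Module 𝕜 (V i)]
  [instFinite : ∀ i, Module.Finite 𝕜 (V i)]
  f : ∀ i : Fin ℓ, V i.castSucc →ₗ[𝕜] V i.succ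

namespace PersistenceModule

attribute [instance] instAddCommGroup instModule instFinite

variable {𝕜 : Type u} [Field 𝕜] {ℓ : ℕ}

/-- Two persistence modules of the same length are isomorphic: there are invertible linear maps
`φ i : V i → W i` which commute with the structure maps. -/
def Isomorphic (M : PersistenceModule.{u, v} 𝕜 ℓ) (N : PersistenceModule.{u, w} 𝕜 ℓ) : Prop :=
  ∃ φ : ∀ i, M.V i ≃ₗ[𝕜] N.V i,
    ∀ (i : Fin ℓ) (x : M.V i.castSucc), φ i.succ (M.f i x) = N.f i (φ i.castSucc x)

/-- The (pointwise) direct sum of a finite family of persistence modules of the same length. -/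
def directSum {ι : Type} [Finite ι] (N : ι → PersistenceModule.{u, v} 𝕜 ℓ) :
    PersistenceModule.{u, v} 𝕜 ℓ where
  V k := ∀ s : ι, (N s).V k
  f k := LinearMap.pi fun s => (N s).f k ∘ₗ LinearMap.proj s

end PersistenceModule

/-- The intervals `[i, j]` with integers `0 ≤ i ≤ j ≤ ℓ`. -/
abbrev BarInterval (ℓ : ℕ) : Type :=
  {p : Fin (ℓ + 1) × Fin (ℓ + 1) // p.1 ≤ p.2}

namespace BarInterval

variable {ℓ : ℕ}

/-- `k ∈ [i, j]`. -/
def Contains (p : BarInterval ℓ) (k : Fin (ℓ + 1)) : Prop :=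
  p.1.1 ≤ k ∧ k ≤ p.1.2

instance (p : BarInterval ℓ) (k : Fin (ℓ + 1)) : Decidable (p.Contains k) :=
  inferInstanceAs (Decidable (_ ∧ _))

/-- The relation `[a, b] ⪯ [c, d]`, that is `a ≤ c ≤ b ≤ d`. -/
def Prec (p q : BarInterval ℓ) : Prop :=
  p.1.1 ≤ q.1.1 ∧ q.1.1 ≤ p.1.2 ∧ p.1.2 ≤ q.1.2

instance (p q : BarInterval ℓ) : Decidable (p.Prec q) :=
  inferInstanceAs (Decidable (_ ∧ _ ∧ _))

end BarInterval

namespace PersistenceModule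

variable {𝕜 : Type u} [Field 𝕜] {ℓ : ℕ}

/-- The interval module of `p = [i, j]`. Its space at `k` consists of the functions to `𝕜` on a
type which has one element if `k ∈ [i, j]` and none otherwise, so it is `𝕜` if `k ∈ [i, j]` and
zero otherwise. The map from `k` to `k + 1` is the identity of `𝕜` if both lie in `[i, j]` and
zero otherwise. -/
def interval (𝕜 : Type u) [Field 𝕜] {ℓ : ℕ} (p : BarInterval ℓ) :
    PersistenceModule.{u, u} 𝕜 ℓ where
  V k := PLift (p.Contains k) → 𝕜
  f k :=
    { toFun := fun x _ => if h : p.Contains k.castSucc then x ⟨h⟩ else 0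
      map_add' := by intro x y; ext; by_cases h : p.Contains k.castSucc <;> simp [h]
      map_smul' := by intro c x; ext; by_cases h : p.Contains k.castSucc <;> simp [h] }

/-- `d p` is the multiplicity of the interval `p` in the barcode of `M`, for each `p` (with
`d p = 0` if `p` is not in the barcode): the module `M` is isomorphic to the direct sum over all
`p` of `d p` copies of the interval module of `p`. -/
def IsBarcode (M : PersistenceModule.{u, v} 𝕜 ℓ) (d : BarInterval ℓ → ℕ) : Prop :=
  M.Isomorphic (directSum fun s : (p : BarInterval ℓ) × Fin (d p) => interval 𝕜 s.1)

/-- The matrices `A i` of the structure maps with respect to a family of ordered bases. -/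
noncomputable def matrixRep (M : PersistenceModule.{u, v} 𝕜 ℓ) {n : Fin (ℓ + 1) → ℕ}
    (B : ∀ i, Module.Basis (Fin (n i)) 𝕜 (M.V i)) (i : Fin ℓ) :
    Matrix (Fin (n i.succ)) (Fin (n i.castSucc)) 𝕜 :=
  LinearMap.toMatrix (B i.castSucc) (B i.succ) (M.f i)

end PersistenceModule

/-- The stabiliser of a sequence of matrices under change of basis: the subgroup of all `g` in
`GL (n 0) × ⋯ × GL (n ℓ)` with `g i * A i * (g (i-1))⁻¹ = A i` for all `1 ≤ i ≤ ℓ`. As a subset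
of a product of general linear groups it carries the subspace topology. -/
def matrixStab {𝕜 : Type u} [Field 𝕜] {ℓ : ℕ} {n : Fin (ℓ + 1) → ℕ}
    (A : ∀ i : Fin ℓ, Matrix (Fin (n i.succ)) (Fin (n i.castSucc)) 𝕜) :
    Subgroup (∀ i : Fin (ℓ + 1), GL (Fin (n i)) 𝕜) where
  carrier := {g | ∀ i : Fin ℓ, (g i.succ).val * A i * (g i.castSucc)⁻¹.val = A i}
  one_mem' := by intro i; simp
  mul_mem' := by
    intro g h hg hh i
    have e : ((g * h) i.succ).val * A i * ((g * h) i.castSucc)⁻¹.val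
        = (g i.succ).val * ((h i.succ).val * A i * (h i.castSucc)⁻¹.val)
          * (g i.castSucc)⁻¹.val := by
      simp only [Pi.mul_apply, mul_inv_rev, Units.val_mul, Matrix.mul_assoc]
    rw [e, hh i, hg i]
  inv_mem' := by
    intro g hg i
    have e : (g i.succ)⁻¹.val * ((g i.succ).val * A i * (g i.castSucc)⁻¹.val)
          * (g i.castSucc).val = A i := by
      rw [Matrix.mul_assoc (g i.succ).val, ← Matrix.mul_assoc, Units.inv_mul, Matrix.one_mul,
        Matrix.mul_assoc, Units.inv_mul, Matrix.mul_one]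
    rw [hg i] at e
    simpa using e

/-- The entries of all the matrices `g 0, …, g ℓ`, as an element of a finite-dimensional normed
space: the inclusion of the stabiliser into the product of the spaces of
`n i × n i` matrices, in which the product of the groups `GL (n i)` is open. -/
def matrixStabEntries {𝕜 : Type u} [Field 𝕜] {ℓ : ℕ} {n : Fin (ℓ + 1) → ℕ}
    (A : ∀ i : Fin ℓ, Matrix (Fin (n i.succ)) (Fin (n i.castSucc)) 𝕜) (g : matrixStab A) :
    ∀ i : Fin (ℓ + 1), Fin (n i) → Fin (n i) → 𝕜 :=
  fun i a b => (g.1 i).val a b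

/-! Clearing the inverse turns the stabiliser condition into the linear equation `g i * A i = A i *
g (i-1)`. So the stabiliser is the set of invertible elements of the linear space `matrixCommutant
A`, an open subset given by nonvanishing determinants. One linear chart covers it, multiplication
and inversion come from analytic maps of the ambient matrix space, and the dimension is that of the
commutant (`exists_lieGroup_matrixStab`).

In the chosen bases the commutant is the endomorphism space of the persistence module
(`finrank_matrixCommutant`). A barcode decomposition splits this space into the Hom spaces from the
interval `p` to the interval `q`, which have dimension one if `q ⪯ p` and zero otherwise
(`finrank_homSpace_interval`); counting with multiplicity gives the sum. Barcodes exist because any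
nonzero module splits off an interval (`exists_interval_summand`, `isomorphic_of_section`), by
induction on the total dimension. -/

/-- A linear map between finite products is a matrix of linear maps. -/
noncomputable def LinearMap.piMatrix {R ι κ : Type*} [CommSemiring R] [Finite ι] {A : ι → Type*}
    {B : κ → Type*} [∀ s, AddCommMonoid (A s)] [∀ s, Module R (A s)] [∀ t, AddCommMonoid (B t)]
    [∀ t, Module R (B t)] :
    ((∀ s, A s) →ₗ[R] ∀ t, B t) ≃ₗ[R] ∀ s t, A s →ₗ[R] B t :=
  letI := Classical.decEq ι
  letI := Fintype.ofFinite ι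
  { toFun := fun φ s t => LinearMap.proj t ∘ₗ φ ∘ₗ LinearMap.single R A s
    invFun := fun ψ => LinearMap.pi fun t => ∑ s, ψ s t ∘ₗ LinearMap.proj s
    map_add' := by intro φ ψ; rfl
    map_smul' := by intro c φ; rfl
    left_inv := by
      intro φ
      refine LinearMap.pi_ext' fun s => LinearMap.ext fun x => funext fun t => ?_
      simp only [LinearMap.comp_apply, LinearMap.single_apply, LinearMap.proj_apply,
        LinearMap.pi_apply, LinearMap.sum_apply]
      rw [Finset.sum_eq_single s]
      · simp
      · intro r _ hr
        simp [hr]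
      · simp
    right_inv := by
      intro ψ
      ext s t x
      simp only [LinearMap.comp_apply, LinearMap.single_apply, LinearMap.proj_apply,
        LinearMap.pi_apply, LinearMap.sum_apply]
      rw [Finset.sum_eq_single s]
      · simp
      · intro r _ hr
        simp [hr]
      · simp }

theorem LinearMap.piMatrix_comp_piMap {R ι κ : Type*} [CommSemiring R] [Finite ι]
    {A A' : ι → Type*} {B : κ → Type*} [∀ s, AddCommMonoid (A s)] [∀ s, Module R (A s)]
    [∀ s, AddCommMonoid (A' s)] [∀ s, Module R (A' s)] [∀ t, AddCommMonoid (B t)]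
    [∀ t, Module R (B t)] (φ : (∀ s, A' s) →ₗ[R] ∀ t, B t) (f : ∀ s, A s →ₗ[R] A' s) (s : ι)
    (t : κ) :
    LinearMap.piMatrix (φ ∘ₗ LinearMap.pi fun s => f s ∘ₗ LinearMap.proj s) s t =
      LinearMap.piMatrix φ s t ∘ₗ f s := by
  classical
  ext x
  change φ _ t = φ _ t
  -- The diagonal map sends the vector `x` in slot `s` to the vector `f s x` in slot `s`.
  refine congrFun (congrArg φ (funext fun r => ?_)) t
  rcases eq_or_ne r s with rfl | hr
  · simp
  · simp [hr]

/-! ### Morphism spaces and their behaviour under direct sums. -/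

namespace PersistenceModule

variable {𝕜 : Type u} [Field 𝕜] {ℓ : ℕ}

/-- The space of morphisms of persistence modules from `M` to `N`. -/
def homSpace (M : PersistenceModule.{u, v} 𝕜 ℓ) (N : PersistenceModule.{u, w} 𝕜 ℓ) :
    Submodule 𝕜 (∀ i, M.V i →ₗ[𝕜] N.V i) where
  carrier := {φ | ∀ i x, φ i.succ (M.f i x) = N.f i (φ i.castSucc x)}
  zero_mem' := by intro i x; simp
  add_mem' := by intro φ ψ hφ hψ i x; simp [hφ i x, hψ i x]
  smul_mem' := by intro c φ hφ i x; simp [hφ i x]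

theorem mem_homSpace {M : PersistenceModule.{u, v} 𝕜 ℓ} {N : PersistenceModule.{u, w} 𝕜 ℓ}
    {φ : ∀ i, M.V i →ₗ[𝕜] N.V i} :
    φ ∈ homSpace M N ↔ ∀ i x, φ i.succ (M.f i x) = N.f i (φ i.castSucc x) :=
  Iff.rfl

/-- Conjugation by an isomorphism of persistence modules. -/
theorem Isomorphic.finrank_homSpace_self {M : PersistenceModule.{u, v} 𝕜 ℓ}
    {N : PersistenceModule.{u, w} 𝕜 ℓ} (h : M.Isomorphic N) :
    Module.finrank 𝕜 (homSpace M M) = Module.finrank 𝕜 (homSpace N N) := by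
  obtain ⟨e, he⟩ := h
  have he' : ∀ i y, (e i.succ).symm (N.f i y) = M.f i ((e i.castSucc).symm y) := by
    intro i y
    rw [LinearEquiv.symm_apply_eq, he, LinearEquiv.apply_symm_apply]
  refine LinearEquiv.finrank_eq ((LinearEquiv.piCongrRight fun i => (e i).conj).ofSubmodules _ _ ?_)
  ext ψ
  simp only [Submodule.mem_map]
  constructor
  · rintro ⟨φ, hφ, rfl⟩ i y
    simp [LinearEquiv.conj_apply, he', ← he, mem_homSpace.1 hφ]
  · intro hψ
    refine ⟨fun i => (e i).symm.conj (ψ i), ?_, ?_⟩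
    · intro i x
      simp [LinearEquiv.conj_apply, ← he', he, mem_homSpace.1 hψ]
    · ext i y
      simp [LinearEquiv.conj_apply]

theorem mem_homSpace_iff_comp {M : PersistenceModule.{u, v} 𝕜 ℓ}
    {N : PersistenceModule.{u, w} 𝕜 ℓ} {φ : ∀ i, M.V i →ₗ[𝕜] N.V i} :
    φ ∈ homSpace M N ↔ ∀ i, φ i.succ ∘ₗ M.f i = N.f i ∘ₗ φ i.castSucc := by
  simp only [mem_homSpace, LinearMap.ext_iff, LinearMap.comp_apply]

/-- The matrix of a linear map between the spaces of two finite direct sums. -/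
noncomputable def directSumMatrix {ι κ : Type} [Finite ι] [Finite κ]
    (M : ι → PersistenceModule.{u, v} 𝕜 ℓ) (N : κ → PersistenceModule.{u, w} 𝕜 ℓ)
    (k k' : Fin (ℓ + 1)) :
    ((directSum M).V k →ₗ[𝕜] (directSum N).V k') ≃ₗ[𝕜] ∀ s t, (M s).V k →ₗ[𝕜] (N t).V k' :=
  LinearMap.piMatrix

/-- The structure maps of a direct sum are diagonal, so each commuting square splits into one square
per matrix entry. -/
theorem mem_homSpace_directSum {ι κ : Type} [Finite ι] [Finite κ]
    {M : ι → PersistenceModule.{u, v} 𝕜 ℓ} {N : κ → PersistenceModule.{u, w} 𝕜 ℓ}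
    {φ : ∀ k, (directSum M).V k →ₗ[𝕜] (directSum N).V k} :
    φ ∈ homSpace (directSum M) (directSum N) ↔
      ∀ s t, (fun k => directSumMatrix M N k k (φ k) s t) ∈ homSpace (M s) (N t) := by
  have h₁ : ∀ k s t, directSumMatrix M N _ _ (φ k.succ ∘ₗ (directSum M).f k) s t =
      directSumMatrix M N _ _ (φ k.succ) s t ∘ₗ (M s).f k := fun k s t =>
    LinearMap.piMatrix_comp_piMap (A := fun s => (M s).V k.castSucc)
      (A' := fun s => (M s).V k.succ) (B := fun t => (N t).V k.succ) _ _ s t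
  have h₂ : ∀ k s t, directSumMatrix M N _ _ ((directSum N).f k ∘ₗ φ k.castSucc) s t =
      (N t).f k ∘ₗ directSumMatrix M N _ _ (φ k.castSucc) s t := fun k s t => rfl
  simp only [mem_homSpace_iff_comp, ← h₁, ← h₂]
  constructor
  · intro h s t k
    rw [h]
  · intro h k
    exact (directSumMatrix M N _ _).injective (funext fun s => funext fun t => h s t k)

/-- A morphism between finite direct sums is a matrix of morphisms. -/
noncomputable def homSpaceDirectSum {ι κ : Type} [Finite ι] [Finite κ]
    (M : ι → PersistenceModule.{u, v} 𝕜 ℓ) (N : κ → PersistenceModule.{u, w} 𝕜 ℓ) :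
    homSpace (directSum M) (directSum N) ≃ₗ[𝕜] ∀ s t, homSpace (M s) (N t) where
  toFun φ s t := ⟨fun k => directSumMatrix M N k k (φ.1 k) s t, mem_homSpace_directSum.1 φ.2 s t⟩
  invFun ψ := ⟨fun k => (directSumMatrix M N k k).symm fun s t => (ψ s t).1 k, by
      rw [mem_homSpace_directSum]
      intro s t
      simpa only [LinearEquiv.apply_symm_apply] using (ψ s t).2⟩
  map_add' φ ψ := by
    refine funext fun s => funext fun t => Subtype.ext (funext fun k => ?_)
    simp
  map_smul' c φ := by
    refine funext fun s => funext fun t => Subtype.ext (funext fun k => ?_)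
    simp
  left_inv φ := by
    refine Subtype.ext (funext fun k => ?_)
    exact LinearEquiv.symm_apply_apply _ _
  right_inv ψ := by
    refine funext fun s => funext fun t => Subtype.ext (funext fun k => ?_)
    exact congrFun (congrFun (LinearEquiv.apply_symm_apply (directSumMatrix M N k k) _) s) t

/-! ### Morphisms between interval modules. -/

theorem interval_f_apply (p : BarInterval ℓ) (k : Fin ℓ)
    (x : (interval 𝕜 p).V k.castSucc) (h' : PLift (p.Contains k.succ)) :
    (interval 𝕜 p).f k x h' = if h : p.Contains k.castSucc then x ⟨h⟩ else 0 :=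
  rfl

/-- The vector of an interval module with all coordinates equal to one. -/
def intervalOne (𝕜 : Type u) [Field 𝕜] (p : BarInterval ℓ) (k : Fin (ℓ + 1)) :
    (interval 𝕜 p).V k :=
  fun _ => 1

theorem interval_eq_smul_one (p : BarInterval ℓ) {k : Fin (ℓ + 1)} (h : p.Contains k)
    (x : (interval 𝕜 p).V k) : x = x ⟨h⟩ • intervalOne 𝕜 p k := by
  funext _
  exact (mul_one (x ⟨h⟩)).symm

/-- The scalar by which a morphism of interval modules acts at `k`. -/
def homCoeff {p q : BarInterval ℓ} (φ : ∀ k, (interval 𝕜 p).V k →ₗ[𝕜] (interval 𝕜 q).V k)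
    (k : Fin (ℓ + 1)) : 𝕜 :=
  if h : p.Contains k ∧ q.Contains k then φ k (intervalOne 𝕜 p k) ⟨h.2⟩ else 0

/-- The commuting square at `k`, evaluated on the all-ones vector. If `p` misses `k + 1` or `q`
misses `k`, the default value 0 of `homCoeff` agrees with the composite that passes through the zero
space, so the lemma also propagates vanishing. -/
theorem homCoeff_succ {p q : BarInterval ℓ}
    {φ : ∀ k, (interval 𝕜 p).V k →ₗ[𝕜] (interval 𝕜 q).V k}
    (hφ : φ ∈ homSpace (interval 𝕜 p) (interval 𝕜 q)) (k : Fin ℓ) (hp : p.Contains k.castSucc)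
    (hq : q.Contains k.succ) : homCoeff φ k.succ = homCoeff φ k.castSucc := by
  have h := congrFun (hφ k (intervalOne 𝕜 p k.castSucc)) ⟨hq⟩
  rw [interval_f_apply] at h
  have h1 : homCoeff φ k.castSucc = if h : q.Contains k.castSucc then
      φ k.castSucc (intervalOne 𝕜 p k.castSucc) ⟨h⟩ else 0 := by
    simp only [homCoeff, hp, true_and]
  rw [h1, ← h]
  by_cases hp' : p.Contains k.succ
  · have h2 : (interval 𝕜 p).f k (intervalOne 𝕜 p k.castSucc) = intervalOne 𝕜 p k.succ := by
      funext _
      rw [interval_f_apply, dif_pos hp]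
      rfl
    rw [h2, homCoeff, dif_pos ⟨hp', hq⟩]
  · have h2 : (interval 𝕜 p).f k (intervalOne 𝕜 p k.castSucc) = 0 := by
      funext h'
      exact absurd h'.down hp'
    rw [h2, map_zero, homCoeff, dif_neg (fun h => hp' h.1)]
    rfl

theorem eq_zero_of_homCoeff {p q : BarInterval ℓ}
    {φ : ∀ k, (interval 𝕜 p).V k →ₗ[𝕜] (interval 𝕜 q).V k} (h : ∀ k, homCoeff φ k = 0) :
    φ = 0 := by
  funext k
  refine LinearMap.ext fun x => funext fun hq => ?_
  by_cases hp : p.Contains k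
  · have h1 := h k
    rw [homCoeff, dif_pos ⟨hp, hq.down⟩] at h1
    rw [interval_eq_smul_one p hp x, map_smul]
    change _ * φ k (intervalOne 𝕜 p k) hq = 0
    rw [show φ k (intervalOne 𝕜 p k) hq = 0 from h1, mul_zero]
  · have h1 : x = 0 := by
      funext h'
      exact absurd h'.down hp
    rw [h1, map_zero, map_zero]

/-- The ranges are half-open on purpose: `q` may miss `i` and `p` may miss `k`. There the
coefficient is 0, which then kills it all along the range. -/
theorem homCoeff_eq_of_mem_homSpace {p q : BarInterval ℓ}
    {φ : ∀ k, (interval 𝕜 p).V k →ₗ[𝕜] (interval 𝕜 q).V k}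
    (hφ : φ ∈ homSpace (interval 𝕜 p) (interval 𝕜 q)) {i k : Fin (ℓ + 1)} (hik : i ≤ k)
    (hp : ∀ j, i ≤ j → j < k → p.Contains j) (hq : ∀ j, i < j → j ≤ k → q.Contains j) :
    homCoeff φ k = homCoeff φ i := by
  induction k using Fin.induction with
  | zero => rw [Fin.le_zero_iff.1 hik]
  | succ k ih =>
    rcases hik.eq_or_lt with rfl | hlt
    · rfl
    have hle : i ≤ k.castSucc := Fin.le_castSucc_iff.2 hlt
    rw [homCoeff_succ hφ k (hp _ hle k.castSucc_lt_succ) (hq _ hlt le_rfl)]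
    exact ih hle (fun j h1 h2 => hp j h1 (h2.trans k.castSucc_lt_succ))
      fun j h1 h2 => hq j h1 (h2.trans k.castSucc_lt_succ.le)

theorem homCoeff_of_not_left {p q : BarInterval ℓ}
    {φ : ∀ k, (interval 𝕜 p).V k →ₗ[𝕜] (interval 𝕜 q).V k} {k : Fin (ℓ + 1)}
    (h : ¬ p.Contains k) : homCoeff φ k = 0 :=
  dif_neg fun h' => h h'.1

theorem homCoeff_of_not_right {p q : BarInterval ℓ}
    {φ : ∀ k, (interval 𝕜 p).V k →ₗ[𝕜] (interval 𝕜 q).V k} {k : Fin (ℓ + 1)}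
    (h : ¬ q.Contains k) : homCoeff φ k = 0 :=
  dif_neg fun h' => h h'.2

/-- A morphism of interval modules `p → q` vanishes unless `q ⪯ p`. -/
theorem eq_zero_of_not_prec {p q : BarInterval ℓ} (h : ¬ q.Prec p)
    {φ : ∀ k, (interval 𝕜 p).V k →ₗ[𝕜] (interval 𝕜 q).V k}
    (hφ : φ ∈ homSpace (interval 𝕜 p) (interval 𝕜 q)) : φ = 0 := by
  refine eq_zero_of_homCoeff fun k => ?_
  by_cases hp : p.Contains k
  swap
  · exact homCoeff_of_not_left hp
  by_cases hq : q.Contains k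
  swap
  · exact homCoeff_of_not_right hq
  rcases lt_or_ge p.1.1 q.1.1 with hlt | hle
  -- If `p` starts before `q`, move left to the position just before `q`, which lies in `p` but not
  -- in `q`.
  · obtain ⟨i, hi⟩ := Fin.exists_succ_eq.2 (Fin.ne_zero_of_lt hlt)
    have hik : i.castSucc ≤ k := (i.castSucc_lt_succ.trans_le (hi.trans_le hq.1)).le
    have hai : p.1.1 ≤ i.castSucc := Fin.le_castSucc_iff.2 (hlt.trans_eq hi.symm)
    rw [homCoeff_eq_of_mem_homSpace hφ hik
      (fun j h1 h2 => ⟨hai.trans h1, h2.le.trans hp.2⟩)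
      (fun j h1 h2 => ⟨hi.symm.trans_le (Fin.castSucc_lt_iff_succ_le.1 h1), h2.trans hq.2⟩)]
    refine homCoeff_of_not_right fun h' => ?_
    exact absurd (h'.1.trans_lt i.castSucc_lt_succ) (hi.symm ▸ lt_irrefl _)
  -- Otherwise the failure of `q ⪯ p` is at the right end: move right to the position just after
  -- `p`, which lies in `q` but not in `p`.
  · have hbd : p.1.2 < q.1.2 := by
      by_contra hbd
      exact h ⟨hle, hp.1.trans hq.2, not_lt.1 hbd⟩
    obtain ⟨j, hj⟩ := Fin.exists_castSucc_eq.2 (Fin.ne_last_of_lt hbd)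
    have hkj : k ≤ j.succ := (hp.2.trans_eq hj.symm).trans j.castSucc_lt_succ.le
    rw [← homCoeff_eq_of_mem_homSpace hφ hkj
      (fun i h1 h2 => ⟨hp.1.trans h1, (Fin.le_castSucc_iff.2 h2).trans_eq hj⟩)
      (fun i h1 h2 => ⟨hq.1.trans h1.le,
        h2.trans (Fin.castSucc_lt_iff_succ_le.1 (hj.trans_lt hbd))⟩)]
    refine homCoeff_of_not_left fun h' => ?_
    exact absurd (j.castSucc_lt_succ.trans_le h'.2) (hj.symm ▸ lt_irrefl _)

theorem _root_.BarInterval.Prec.contains_left {p q : BarInterval ℓ} (h : q.Prec p) :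
    q.Contains p.1.1 :=
  ⟨h.1, h.2.1⟩

theorem _root_.BarInterval.contains_left (p : BarInterval ℓ) : p.Contains p.1.1 :=
  ⟨le_rfl, p.2⟩

theorem homCoeff_eq_left {p q : BarInterval ℓ} (h : q.Prec p)
    {φ : ∀ k, (interval 𝕜 p).V k →ₗ[𝕜] (interval 𝕜 q).V k}
    (hφ : φ ∈ homSpace (interval 𝕜 p) (interval 𝕜 q)) {k : Fin (ℓ + 1)} (hp : p.Contains k)
    (hq : q.Contains k) : homCoeff φ k = homCoeff φ p.1.1 :=
  homCoeff_eq_of_mem_homSpace hφ hp.1 (fun _ h1 h2 => ⟨h1, h2.le.trans hp.2⟩)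
    fun _ h1 h2 => ⟨h.1.trans h1.le, h2.trans hq.2⟩

/-- The morphism of interval modules `p → q` which is the identity where both are nonzero. -/
def intervalMap (𝕜 : Type u) [Field 𝕜] (p q : BarInterval ℓ) (k : Fin (ℓ + 1)) :
    (interval 𝕜 p).V k →ₗ[𝕜] (interval 𝕜 q).V k where
  toFun x _ := if h : p.Contains k then x ⟨h⟩ else 0
  map_add' x y := by
    funext _
    change (if h : p.Contains k then x ⟨h⟩ + y ⟨h⟩ else 0) =
      (if h : p.Contains k then x ⟨h⟩ else 0) + (if h : p.Contains k then y ⟨h⟩ else 0)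
    split <;> simp
  map_smul' c x := by
    funext _
    change (if h : p.Contains k then c * x ⟨h⟩ else 0) =
      c * (if h : p.Contains k then x ⟨h⟩ else 0)
    split <;> simp

theorem intervalMap_apply (p q : BarInterval ℓ) (k : Fin (ℓ + 1)) (x : (interval 𝕜 p).V k)
    (h' : PLift (q.Contains k)) :
    intervalMap 𝕜 p q k x h' = if h : p.Contains k then x ⟨h⟩ else 0 :=
  rfl

theorem intervalMap_mem_homSpace {p q : BarInterval ℓ} (h : q.Prec p) :
    intervalMap 𝕜 p q ∈ homSpace (interval 𝕜 p) (interval 𝕜 q) := by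
  intro k x
  funext hq
  simp only [intervalMap_apply, interval_f_apply]
  by_cases hp : p.Contains k.castSucc
  · have hp' : p.Contains k.succ :=
      ⟨hp.1.trans k.castSucc_lt_succ.le, hq.down.2.trans h.2.2⟩
    have hq' : q.Contains k.castSucc :=
      ⟨h.1.trans hp.1, k.castSucc_lt_succ.le.trans hq.down.2⟩
    rw [dif_pos hp', dif_pos hq']
  · simp [hp]

/-- The dimension of the space of morphisms between two interval modules. -/
theorem finrank_homSpace_interval (p q : BarInterval ℓ) :
    Module.finrank 𝕜 (homSpace (interval 𝕜 p) (interval 𝕜 q)) = if q.Prec p then 1 else 0 := by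
  split_ifs with h
  · have hq := BarInterval.Prec.contains_left h
    have hp := BarInterval.contains_left p
    have hev : ∀ φ : homSpace (interval 𝕜 p) (interval 𝕜 q),
        homCoeff φ.1 p.1.1 = φ.1 p.1.1 (intervalOne 𝕜 p p.1.1) ⟨hq⟩ := fun φ =>
      dif_pos ⟨hp, hq⟩
    -- The left end of `p` lies in both intervals and the coefficient is constant on their overlap,
    -- so evaluation there identifies the morphism space with `𝕜`.
    let ev : homSpace (interval 𝕜 p) (interval 𝕜 q) →ₗ[𝕜] 𝕜 :=
      { toFun := fun φ => φ.1 p.1.1 (intervalOne 𝕜 p p.1.1) ⟨hq⟩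
        map_add' := fun φ ψ => rfl
        map_smul' := fun c φ => rfl }
    have hinj : Function.Injective ev := by
      rw [← LinearMap.ker_eq_bot, LinearMap.ker_eq_bot']
      intro φ hφ
      refine Subtype.ext (eq_zero_of_homCoeff fun k => ?_)
      by_cases hpk : p.Contains k
      · by_cases hqk : q.Contains k
        · rw [homCoeff_eq_left h φ.2 hpk hqk, hev]
          exact hφ
        · exact homCoeff_of_not_right hqk
      · exact homCoeff_of_not_left hpk
    have hsurj : Function.Surjective ev := by
      intro c
      refine ⟨c • ⟨intervalMap 𝕜 p q, intervalMap_mem_homSpace h⟩, ?_⟩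
      rw [map_smul]
      change c * (if h : p.Contains p.1.1 then (1 : 𝕜) else 0) = c
      rw [dif_pos hp, mul_one]
    rw [(LinearEquiv.ofBijective ev ⟨hinj, hsurj⟩).finrank_eq, Module.finrank_self]
  · have : Subsingleton (homSpace (interval 𝕜 p) (interval 𝕜 q)) :=
      subsingleton_of_forall_eq 0 fun φ => Subtype.ext (eq_zero_of_not_prec h φ.2)
    exact Module.finrank_zero_of_subsingleton

/-- The dimension of the endomorphism algebra of a module in terms of its barcode. -/
theorem IsBarcode.finrank_homSpace_self {M : PersistenceModule.{u, v} 𝕜 ℓ}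
    {d : BarInterval ℓ → ℕ} (h : M.IsBarcode d) :
    Module.finrank 𝕜 (homSpace M M) =
      ∑ pq : BarInterval ℓ × BarInterval ℓ with pq.1.Prec pq.2, d pq.1 * d pq.2 := by
  have key : ∀ (s t : (p : BarInterval ℓ) × Fin (d p)),
      Module.finrank 𝕜 (homSpace (interval 𝕜 s.1) (interval 𝕜 t.1)) =
        if t.1.Prec s.1 then 1 else 0 := fun s t => by
    rw [finrank_homSpace_interval]
  rw [Isomorphic.finrank_homSpace_self h, (homSpaceDirectSum _ _).finrank_eq,
    Module.finrank_pi_fintype]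
  simp only [Module.finrank_pi_fintype, key, Fintype.sum_sigma]
  -- A morphism from `p` to `q` is counted by the pair `(q, p)`, so the outer sum runs over the
  -- second component.
  rw [Finset.sum_filter, Fintype.sum_prod_type_right]
  refine Finset.sum_congr rfl fun p _ => ?_
  rw [Finset.sum_comm]
  refine Finset.sum_congr rfl fun q _ => ?_
  split_ifs <;> simp [mul_comm]

/-! ### Existence of interval decompositions. -/

/-- A persistence module which is not zero contains a vector spanning an interval module, together
with functionals which exhibit this interval module as a direct summand. -/
theorem exists_interval_summand (M : PersistenceModule.{u, v} 𝕜 ℓ)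
    (hM : ∃ i, Nontrivial (M.V i)) :
    ∃ (p : BarInterval ℓ) (x : ∀ k, M.V k) (φ : ∀ k, M.V k →ₗ[𝕜] 𝕜),
      (∀ k, ¬ p.Contains k → x k = 0) ∧ (∀ k, ¬ p.Contains k → φ k = 0) ∧
      (∀ k, p.Contains k → φ k (x k) = 1) ∧
      (∀ k : Fin ℓ, p.Contains k.castSucc → M.f k (x k.castSucc) = x k.succ) ∧
      (∀ k : Fin ℓ, p.Contains k.succ → φ k.succ ∘ₗ M.f k = φ k.castSucc) := by
  classical
  -- Starting at the first nonzero space makes everything to the left of `i` vanish, so no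
  -- compatibility condition arises there.
  obtain ⟨i, hi, hmin⟩ : ∃ i, Nontrivial (M.V i) ∧ ∀ k < i, ¬ Nontrivial (M.V k) := by
    obtain ⟨i, hi⟩ := exists_minimal_of_wellFoundedLT (fun i => Nontrivial (M.V i)) hM
    exact ⟨i, hi.prop, fun k hk => hi.not_prop_of_lt hk⟩
  have hsub : ∀ k < i, Subsingleton (M.V k) := fun k hk =>
    not_nontrivial_iff_subsingleton.1 (hmin k hk)
  obtain ⟨v, hv⟩ := exists_ne (0 : M.V i)
  obtain ⟨x, hxi, hx⟩ : ∃ x : ∀ k, M.V k, x i ≠ 0 ∧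
      ∀ k : Fin ℓ, i ≤ k.castSucc → M.f k (x k.castSucc) = x k.succ := by
    -- Push `v` forward along the structure maps; the summand `w` injects it at `i`.
    let w : ∀ k, M.V k := Pi.single i v
    let x : ∀ k, M.V k := Fin.induction (w 0) fun k y => M.f k y + w k.succ
    have hx : ∀ k : Fin ℓ, x k.succ = M.f k (x k.castSucc) + w k.succ := fun k => rfl
    refine ⟨x, ?_, fun k hk => ?_⟩
    · have hw : w i = v := Pi.single_eq_same i v
      suffices x i = w i by rwa [this, hw]
      clear_value w
      cases i using Fin.cases with
      | zero => rfl
      | succ k =>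
        have := hsub k.castSucc k.castSucc_lt_succ
        rw [hx, Subsingleton.elim (x k.castSucc) 0, map_zero, zero_add]
    · have hw : w k.succ = 0 := Pi.single_eq_of_ne (hk.trans_lt k.castSucc_lt_succ).ne' v
      rw [hx, hw, add_zero]
  -- The interval ends where the image of `v` dies.
  obtain ⟨j, hj, hmax⟩ : ∃ j, x j ≠ 0 ∧ ∀ k > j, x k = 0 := by
    obtain ⟨j, hj⟩ := exists_maximal_of_wellFoundedGT (fun j => x j ≠ 0) ⟨i, hxi⟩
    exact ⟨j, hj.prop, fun k hk => not_not.1 (hj.not_prop_of_gt hk)⟩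
  have hij : i ≤ j := not_lt.1 fun h => hxi (hmax i h)
  obtain ⟨ψ, hψ⟩ : ∃ ψ : M.V j →ₗ[𝕜] 𝕜, ψ (x j) = 1 := Module.Projective.exists_dual_eq_one 𝕜 hj
  obtain ⟨φ, hφj, hφ0, hφ⟩ : ∃ φ : ∀ k, M.V k →ₗ[𝕜] 𝕜, φ j = ψ ∧ (∀ k > j, φ k = 0) ∧
      ∀ k : Fin ℓ, k.succ ≤ j → φ k.succ ∘ₗ M.f k = φ k.castSucc := by
    -- Dually, pull `ψ` back from `j`. The pairing of `φ k` with `x k` is then constant on `[i, j]`,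
    -- equal to its value 1 at `j`.
    let w : ∀ k, M.V k →ₗ[𝕜] 𝕜 := Pi.single j ψ
    let φ : ∀ k, M.V k →ₗ[𝕜] 𝕜 :=
      Fin.reverseInduction (w (Fin.last ℓ)) fun k y => y ∘ₗ M.f k + w k.castSucc
    have hlast : φ (Fin.last ℓ) = w (Fin.last ℓ) := Fin.reverseInduction_last ..
    have hφ : ∀ k : Fin ℓ, φ k.castSucc = φ k.succ ∘ₗ M.f k + w k.castSucc := fun k =>
      Fin.reverseInduction_castSucc ..
    have hwj : w j = ψ := Pi.single_eq_same (M := fun k => M.V k →ₗ[𝕜] 𝕜) j ψ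
    have hw : ∀ k, k ≠ j → w k = 0 := fun k hk =>
      Pi.single_eq_of_ne (M := fun k => M.V k →ₗ[𝕜] 𝕜) hk ψ
    clear_value φ w
    have h0 : ∀ k > j, φ k = 0 := by
      intro k
      induction k using Fin.reverseInduction with
      | last => intro h; rw [hlast, hw _ h.ne']
      | cast k ih =>
        intro h
        rw [hφ, ih (h.trans k.castSucc_lt_succ), hw _ h.ne', LinearMap.zero_comp, add_zero]
    refine ⟨φ, ?_, h0, fun k hk => ?_⟩
    · rw [← hwj]
      cases j using Fin.lastCases with
      | last => exact hlast
      | cast k => rw [hφ, h0 _ k.castSucc_lt_succ, LinearMap.zero_comp, zero_add]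
    · rw [hφ, hw _ (k.castSucc_lt_succ.trans_le hk).ne, add_zero]
  have hone : ∀ k, i ≤ k → k ≤ j → φ k (x k) = 1 := by
    intro k
    induction k using Fin.reverseInduction with
    | last =>
      intro _ h
      obtain rfl := h.antisymm (Fin.le_last j)
      rw [hφj, hψ]
    | cast k ih =>
      intro h1 h2
      rcases h2.eq_or_lt with rfl | hlt
      · rw [hφj, hψ]
      · have hle := Fin.castSucc_lt_iff_succ_le.1 hlt
        rw [← hφ k hle, LinearMap.comp_apply, hx k h1]
        exact ih (h1.trans k.castSucc_lt_succ.le) hle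
  refine ⟨⟨(i, j), hij⟩, x, φ, ?_, ?_, fun k hk => hone k hk.1 hk.2, fun k hk => hx k hk.1,
    fun k hk => hφ k hk.2⟩
  · intro k hk
    rcases lt_or_ge k i with h | h
    · exact @Subsingleton.elim _ (hsub k h) _ _
    · exact hmax k (not_le.1 fun h' => hk ⟨h, h'⟩)
  · intro k hk
    rcases lt_or_ge k i with h | h
    · have := hsub k h
      exact LinearMap.ext fun y => by rw [Subsingleton.elim y 0, map_zero, map_zero]
    · exact hφ0 k (not_le.1 fun h' => hk ⟨h, h'⟩)

/-- The kernel of a morphism, as a persistence module. -/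
def kernel (M : PersistenceModule.{u, v} 𝕜 ℓ) {N : PersistenceModule.{u, w} 𝕜 ℓ}
    {π : ∀ k, M.V k →ₗ[𝕜] N.V k} (hπ : π ∈ homSpace M N) : PersistenceModule.{u, v} 𝕜 ℓ where
  V k := LinearMap.ker (π k)
  f k := (M.f k).restrict fun x hx => by
    rw [LinearMap.mem_ker] at hx ⊢
    rw [hπ, hx, map_zero]

/-- If a morphism to an interval module has a section and its kernel is a direct sum of interval
modules, then so is the module. -/
theorem isomorphic_of_section {M : PersistenceModule.{u, v} 𝕜 ℓ} {p : BarInterval ℓ}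
    {π : ∀ k, M.V k →ₗ[𝕜] (interval 𝕜 p).V k} (hπ : π ∈ homSpace M (interval 𝕜 p))
    {σ : ∀ k, (interval 𝕜 p).V k →ₗ[𝕜] M.V k} (hσ : σ ∈ homSpace (interval 𝕜 p) M)
    (hπσ : ∀ k y, π k (σ k y) = y) {ι : Type} [Finite ι] {s : ι → BarInterval ℓ}
    (h : (M.kernel hπ).Isomorphic (directSum fun i => interval 𝕜 (s i))) :
    M.Isomorphic (directSum fun o : Option ι => interval 𝕜 (o.elim p s)) := by
  obtain ⟨e, he⟩ := h
  -- The projection to the kernel along the image of `σ`. Together with `π` it gives the splitting,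
  -- with `none` labelling the new interval.
  let r : ∀ k, M.V k →ₗ[𝕜] (M.kernel hπ).V k := fun k =>
    (LinearMap.id - σ k ∘ₗ π k).codRestrict (LinearMap.ker (π k)) fun x => by
      simp [hπσ]
  have hr : ∀ k x, (r k x : LinearMap.ker (π k)).1 = x - σ k (π k x) := fun k x => rfl
  have hrf : ∀ (k : Fin ℓ) x, r k.succ (M.f k x) = (M.kernel hπ).f k (r k.castSucc x) := by
    intro k x
    refine Subtype.ext ?_
    rw [hr]
    change _ = M.f k (x - σ _ (π _ x))
    rw [map_sub, hπ, hσ]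
  let c : ∀ k, M.V k → ∀ o : Option ι, (interval 𝕜 (o.elim p s)).V k := fun k x o =>
    match o with
    | none => π k x
    | some i => (e k (r k x) : ∀ i, (interval 𝕜 (s i)).V k) i
  let g : ∀ k, M.V k →ₗ[𝕜] (directSum fun o : Option ι => interval 𝕜 (o.elim p s)).V k :=
    fun k =>
    { toFun := c k
      map_add' := by
        intro x y
        funext o
        cases o with
        | none => exact map_add (π k) x y
        | some i =>
          change (e k (r k (x + y)) : ∀ i, (interval 𝕜 (s i)).V k) i = _
          rw [map_add, map_add]
          rfl
      map_smul' := by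
        intro a x
        funext o
        cases o with
        | none => exact map_smul (π k) a x
        | some i =>
          change (e k (r k (a • x)) : ∀ i, (interval 𝕜 (s i)).V k) i = _
          rw [map_smul, map_smul]
          rfl }
  have hg₀ : ∀ k x, g k x none = π k x := fun k x => rfl
  have hg₁ : ∀ k x, (fun i => g k x (some i)) = e k (r k x) := fun k x => rfl
  have hbij : ∀ k, Function.Bijective (g k) := by
    intro k
    constructor
    · rw [← LinearMap.ker_eq_bot, LinearMap.ker_eq_bot']
      intro x hx
      have h₀ : π k x = 0 := by rw [← hg₀, hx]; rfl
      have h₁ : e k (r k x) = 0 := by rw [← hg₁, hx]; rfl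
      rw [LinearEquiv.map_eq_zero_iff] at h₁
      have h₂ := congrArg Subtype.val h₁
      rw [hr, h₀, map_zero, sub_zero] at h₂
      exact h₂
    · intro y
      let z : (M.kernel hπ).V k := (e k).symm fun i => y (some i)
      have hz : π k z.1 = 0 := z.2
      obtain ⟨y₀, hy₀⟩ : ∃ y₀ : (interval 𝕜 p).V k, y₀ = y none := ⟨_, rfl⟩
      have hx : π k (σ k y₀ + z.1) = y₀ := by rw [map_add, hπσ, hz, add_zero]
      refine ⟨σ k y₀ + z.1, ?_⟩
      funext o
      cases o with
      | none => exact hx.trans hy₀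
      | some i =>
        have hrz : r k (σ k y₀ + z.1) = z := by
          refine Subtype.ext ?_
          rw [hr, hx, add_sub_cancel_left]
        have h₁ := hg₁ k (σ k y₀ + z.1)
        rw [hrz] at h₁
        exact (congrFun h₁ i).trans
          (congrFun (LinearEquiv.apply_symm_apply (e k) fun i => y (some i)) i)
  refine ⟨fun k => LinearEquiv.ofBijective (g k) (hbij k), fun k x => ?_⟩
  funext o
  cases o with
  | none => exact hπ k x
  | some i =>
    have h₁ := hg₁ k.succ (M.f k x)
    rw [hrf, he] at h₁
    exact congrFun h₁ i

/-- Every persistence module is isomorphic to a finite direct sum of interval modules. -/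
theorem exists_isomorphic_directSum_interval (M : PersistenceModule.{u, v} 𝕜 ℓ) :
    ∃ (ι : Type) (_ : Finite ι) (s : ι → BarInterval ℓ),
      M.Isomorphic (directSum fun i => interval 𝕜 (s i)) := by
  induction hN : ∑ k, Module.finrank 𝕜 (M.V k) using Nat.strong_induction_on generalizing M with
  | _ N ih =>
  by_cases hM : ∃ i, Nontrivial (M.V i)
  · obtain ⟨p, x, φ, hx, hφ, hone, hxf, hφf⟩ := exists_interval_summand M hM
    let π : ∀ k, M.V k →ₗ[𝕜] (interval 𝕜 p).V k := fun k => LinearMap.pi fun _ => φ k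
    have hπa : ∀ k y h, π k y h = φ k y := fun k y h => rfl
    have hπ : π ∈ homSpace M (interval 𝕜 p) := by
      intro k y
      funext h
      rw [interval_f_apply, hπa, ← LinearMap.comp_apply, hφf k h.down]
      split_ifs with h'
      · rfl
      · rw [hφ _ h']
        rfl
    let σ : ∀ k, (interval 𝕜 p).V k →ₗ[𝕜] M.V k := fun k =>
      if h : p.Contains k then
        (LinearMap.proj (⟨h⟩ : PLift (p.Contains k)) : (PLift (p.Contains k) → 𝕜) →ₗ[𝕜] 𝕜).smulRight
          (x k)
      else 0
    have hσ₁ : ∀ k (h : p.Contains k) y, σ k y = y ⟨h⟩ • x k := fun k h y =>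
      DFunLike.congr_fun (dif_pos h) y
    have hσ₀ : ∀ k (h : ¬ p.Contains k) y, σ k y = 0 := fun k h y =>
      DFunLike.congr_fun (dif_neg h) y
    have hσ : σ ∈ homSpace (interval 𝕜 p) M := by
      intro k y
      by_cases h : p.Contains k.castSucc
      · rw [hσ₁ _ h, map_smul, hxf k h]
        by_cases h' : p.Contains k.succ
        · rw [hσ₁ _ h', interval_f_apply, dif_pos h]
        · rw [hσ₀ _ h', hx _ h', smul_zero]
      · rw [hσ₀ _ h, map_zero]
        by_cases h' : p.Contains k.succ
        · rw [hσ₁ _ h', interval_f_apply, dif_neg h, zero_smul]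
        · rw [hσ₀ _ h']
    have hπσ : ∀ k y, π k (σ k y) = y := by
      intro k y
      funext h
      rw [hπa, hσ₁ k h.down, map_smul, hone k h.down, smul_eq_mul, mul_one]
    have hle : ∀ k, Module.finrank 𝕜 ((M.kernel hπ).V k) ≤ Module.finrank 𝕜 (M.V k) := fun k =>
      Submodule.finrank_le (LinearMap.ker (π k))
    -- The dimension drops at the left end of `p`, where `φ` takes the value 1 on `x`.
    have hlt : Module.finrank 𝕜 ((M.kernel hπ).V p.1.1) < Module.finrank 𝕜 (M.V p.1.1) := by
      refine Submodule.finrank_lt (s := LinearMap.ker (π p.1.1)) fun htop => ?_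
      have h₁ : π p.1.1 (x p.1.1) = 0 := by
        rw [← LinearMap.mem_ker, htop]
        trivial
      have h₂ := congrFun h₁ ⟨p.contains_left⟩
      rw [hπa, hone _ p.contains_left] at h₂
      exact one_ne_zero h₂
    obtain ⟨ι, hι, s, hs⟩ := ih _
      (hN ▸ Finset.sum_lt_sum (fun k _ => hle k) ⟨_, Finset.mem_univ _, hlt⟩) (M.kernel hπ) rfl
    exact ⟨Option ι, inferInstance, _, isomorphic_of_section hπ hσ hπσ hs⟩
  · have hsub : ∀ k, Subsingleton (M.V k) := fun k =>
      not_nontrivial_iff_subsingleton.1 fun h => hM ⟨k, h⟩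
    refine ⟨Empty, inferInstance, Empty.elim, fun k => ?_, fun k x => ?_⟩
    · have : Subsingleton ((directSum fun i : Empty => interval 𝕜 (i.elim : BarInterval ℓ)).V k) :=
        inferInstanceAs (Subsingleton (∀ _ : Empty, _))
      exact 0
    · funext i
      exact i.elim

/-- Existence of the barcode. -/
theorem exists_isBarcode (M : PersistenceModule.{u, v} 𝕜 ℓ) : ∃ d, M.IsBarcode d := by
  classical
  obtain ⟨ι, hι, s, φ, hφ⟩ := exists_isomorphic_directSum_interval M
  let := Fintype.ofFinite ι
  -- The multiplicity of `p` is the size of the fibre of `s` over it; `ε` reindexes the sum by these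
  -- fibres.
  let d : BarInterval ℓ → ℕ := fun p => Fintype.card {i // s i = p}
  let ε : ((p : BarInterval ℓ) × Fin (d p)) ≃ ι :=
    (Equiv.sigmaCongrRight fun p => (Fintype.equivFin {i // s i = p}).symm).trans
      (Equiv.sigmaFiberEquiv s)
  have hε : ∀ t, s (ε t) = t.1 := fun t => ((Fintype.equivFin {i // s i = t.1}).symm t.2).2
  have hN : (fun t : (p : BarInterval ℓ) × Fin (d p) => interval 𝕜 (s (ε t))) =
      fun t => interval 𝕜 t.1 := funext fun t => by rw [hε]
  refine ⟨d, ?_⟩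
  rw [IsBarcode, ← hN]
  refine ⟨fun k => (φ k).trans
    (LinearEquiv.piCongrLeft' 𝕜 (fun i => (interval 𝕜 (s i)).V k) ε.symm), fun k x => ?_⟩
  funext t
  exact congrFun (hφ k x) (ε t)

end PersistenceModule

/-! ### The linear commutant and its dimension. -/

/-- The block matrices which commute with a sequence of matrices. -/
def matrixCommutant {𝕜 : Type u} [Field 𝕜] {ℓ : ℕ} {n : Fin (ℓ + 1) → ℕ}
    (A : ∀ i : Fin ℓ, Matrix (Fin (n i.succ)) (Fin (n i.castSucc)) 𝕜) :
    Submodule 𝕜 (∀ i : Fin (ℓ + 1), Fin (n i) → Fin (n i) → 𝕜) where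
  carrier := {g | ∀ i, Matrix.of (g i.succ) * A i = A i * Matrix.of (g i.castSucc)}
  zero_mem' := by
    intro i
    change (0 : Matrix _ _ 𝕜) * _ = _ * (0 : Matrix _ _ 𝕜)
    simp
  add_mem' := by
    intro g h hg hh i
    change (Matrix.of (g i.succ) + Matrix.of (h i.succ)) * _ =
      _ * (Matrix.of (g i.castSucc) + Matrix.of (h i.castSucc))
    rw [Matrix.add_mul, Matrix.mul_add, hg i, hh i]
  smul_mem' := by
    intro c g hg i
    change (c • Matrix.of (g i.succ)) * _ = _ * (c • Matrix.of (g i.castSucc))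
    rw [Matrix.smul_mul, Matrix.mul_smul, hg i]

theorem mem_matrixStab_iff {𝕜 : Type u} [Field 𝕜] {ℓ : ℕ} {n : Fin (ℓ + 1) → ℕ}
    {A : ∀ i : Fin ℓ, Matrix (Fin (n i.succ)) (Fin (n i.castSucc)) 𝕜}
    {g : ∀ i : Fin (ℓ + 1), GL (Fin (n i)) 𝕜} :
    g ∈ matrixStab A ↔ ∀ i : Fin ℓ, (g i.succ).val * A i = A i * (g i.castSucc).val := by
  refine forall_congr' fun i => ⟨fun h => ?_, fun h => ?_⟩
  · conv_rhs => rw [← h]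
    rw [Matrix.mul_assoc, Units.inv_mul, Matrix.mul_one]
  · rw [h, Matrix.mul_assoc, Units.mul_inv, Matrix.mul_one]

/-- Passing to matrices in the bases `B` carries composition to multiplication, so it matches the
two commutation conditions. -/
theorem PersistenceModule.finrank_matrixCommutant {𝕜 : Type u} [Field 𝕜] {ℓ : ℕ}
    (M : PersistenceModule.{u, v} 𝕜 ℓ) {n : Fin (ℓ + 1) → ℕ}
    (B : ∀ i, Module.Basis (Fin (n i)) 𝕜 (M.V i)) :
    Module.finrank 𝕜 (matrixCommutant (M.matrixRep B)) = Module.finrank 𝕜 (homSpace M M) := by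
  let E : (∀ i, M.V i →ₗ[𝕜] M.V i) ≃ₗ[𝕜] ∀ i, Fin (n i) → Fin (n i) → 𝕜 :=
    LinearEquiv.piCongrRight fun i =>
      (LinearMap.toMatrix (B i) (B i)).trans (Matrix.ofLinearEquiv 𝕜).symm
  have hE : ∀ φ, E φ ∈ matrixCommutant (M.matrixRep B) ↔ φ ∈ homSpace M M := by
    intro φ
    rw [mem_homSpace_iff_comp]
    refine forall_congr' fun i => ?_
    rw [← (LinearMap.toMatrix (B i.castSucc) (B i.succ)).injective.eq_iff,
      LinearMap.toMatrix_comp _ (B i.succ), LinearMap.toMatrix_comp _ (B i.castSucc)]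
    rfl
  refine (LinearEquiv.finrank_eq (E.ofSubmodules _ _ ?_)).symm
  ext g
  rw [Submodule.mem_map_equiv, ← hE, LinearEquiv.apply_symm_apply]

/-! ### Analyticity of determinant, inverse and product, tested entrywise. -/

section Smooth

variable {𝕜 : Type u} [RCLike 𝕜]

theorem ContDiffAt.matrix_det {F : Type*} [NormedAddCommGroup F] [NormedSpace 𝕜 F] {m : Type*}
    [Fintype m] [DecidableEq m] {k : ℕ∞ω} {f : F → Matrix m m 𝕜} {x : F}
    (hf : ∀ a b, ContDiffAt 𝕜 k (fun y => f y a b) x) : ContDiffAt 𝕜 k (fun y => (f y).det) x := by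
  simp only [Matrix.det_apply']
  exact ContDiffAt.sum fun σ _ => contDiffAt_const.mul (contDiffAt_prod fun i _ => hf _ _)

theorem ContDiffAt.matrix_inv {F : Type*} [NormedAddCommGroup F] [NormedSpace 𝕜 F] {m : Type*}
    [Fintype m] [DecidableEq m] {k : ℕ∞ω} {f : F → Matrix m m 𝕜} {x : F}
    (hf : ∀ a b, ContDiffAt 𝕜 k (fun y => f y a b) x) (hx : (f x).det ≠ 0) (a b : m) :
    ContDiffAt 𝕜 k (fun y => (f y)⁻¹ a b) x := by
  simp only [Matrix.inv_def, Matrix.smul_apply, Ring.inverse_eq_inv', smul_eq_mul,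
    Matrix.adjugate_apply]
  refine ((ContDiffAt.matrix_det hf).inv hx).mul (ContDiffAt.matrix_det fun i j => ?_)
  -- Each adjugate entry is the determinant of the matrix with row `b` replaced by a constant row.
  by_cases h : i = b
  · subst h
    simpa only [Matrix.updateRow_self] using contDiffAt_const
  · simpa only [Matrix.updateRow_ne h] using hf i j

theorem ContDiffAt.matrix_mul {F : Type*} [NormedAddCommGroup F] [NormedSpace 𝕜 F] {m : Type*}
    [Fintype m] {k : ℕ∞ω} {f g : F → Matrix m m 𝕜} {x : F}
    (hf : ∀ a b, ContDiffAt 𝕜 k (fun y => f y a b) x)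
    (hg : ∀ a b, ContDiffAt 𝕜 k (fun y => g y a b) x) (a b : m) :
    ContDiffAt 𝕜 k (fun y => (f y * g y) a b) x := by
  simp only [Matrix.mul_apply]
  exact ContDiffAt.sum fun i _ => (hf _ _).mul (hg _ _)

end Smooth

/-! ### Lie groups with a single chart onto an open subset of a linear subspace. -/

section LinearChart

variable {𝕜 : Type*} [NontriviallyNormedField 𝕜] {E W : Type*}
  [NormedAddCommGroup E] [NormedSpace 𝕜 E] [NormedAddCommGroup W] [NormedSpace 𝕜 W]
  {G : Type*} [TopologicalSpace G]

/-- If an open embedding into a linear subspace of a normed space, with a continuous linear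
projection, is used as a global chart, then the inclusion is a smooth embedding. -/
theorem Topology.IsOpenEmbedding.isSmoothEmbedding_singleton [Nonempty G] {φ : G → E}
    (hφ : Topology.IsOpenEmbedding φ) (ι : E →L[𝕜] W) (r : W →L[𝕜] E)
    (hr : Function.LeftInverse r ι) (k : ℕ∞ω) :
    letI := hφ.singletonChartedSpace
    Manifold.IsSmoothEmbedding 𝓘(𝕜, E) 𝓘(𝕜, W) k (fun g => ι (φ g)) := by
  let := hφ.singletonChartedSpace
  have : IsManifold 𝓘(𝕜, E) k G := hφ.isManifold_singleton
  refine ⟨Manifold.IsImmersionOfComplement.isImmersion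
    (F := LinearMap.ker (r : W →ₗ[𝕜] E)) fun g => ?_, ?_⟩
  -- The left inverse `r` splits `W` as `E × ker r`, and in these coordinates the inclusion is `y ↦
  -- (y, 0)`.
  · refine Manifold.IsImmersionAtOfComplement.mk_of_charts
      (ContinuousLinearEquiv.equivOfRightInverse r ι hr).symm (chartAt E g)
      (OpenPartialHomeomorph.refl W) (mem_chart_source E g) (Set.mem_univ _)
      (IsManifold.chart_mem_maximalAtlas g) ?_ (fun _ _ => Set.mem_univ _) ?_
    · exact IsManifold.subset_maximalAtlas (by simp)
    · intro y hy
      obtain ⟨g', rfl⟩ : ∃ g', φ g' = y := by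
        exact ⟨(chartAt E g).symm y, (chartAt E g).right_inv (by simpa using hy)⟩
      have hsymm : (chartAt E g).symm (φ g') = g' :=
        (chartAt E g).left_inv (Set.mem_univ g')
      suffices ι (φ ((chartAt E g).symm (φ g'))) = ι (φ g') by simpa using this
      rw [hsymm]
  · exact (hr.isEmbedding r.continuous ι.continuous).comp hφ.isEmbedding

/-- Smoothness of the group operations can be tested in an ambient normed space. -/
theorem Topology.IsOpenEmbedding.lieGroup_singleton [Group G] {φ : G → E}
    (hφ : Topology.IsOpenEmbedding φ) (ι : E →L[𝕜] W) (r : W →L[𝕜] E)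
    (hr : Function.LeftInverse r ι) {k : ℕ∞ω} {μ : W × W → W} {ν : W → W}
    (hμ : ContDiff 𝕜 k μ) (hν : ∀ g, ContDiffAt 𝕜 k ν (ι (φ g)))
    (hmul : ∀ g h, ι (φ (g * h)) = μ (ι (φ g), ι (φ h)))
    (hinv : ∀ g, ι (φ g⁻¹) = ν (ι (φ g))) :
    letI := hφ.singletonChartedSpace
    LieGroup 𝓘(𝕜, E) k G := by
  let := hφ.singletonChartedSpace
  have : IsManifold 𝓘(𝕜, E) k G := hφ.isManifold_singleton
  have hj : ContMDiff 𝓘(𝕜, E) 𝓘(𝕜, W) k fun g => ι (φ g) :=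
    ι.contDiff.contMDiff.comp (contMDiff_isOpenEmbedding hφ)
  refine { contMDiff_mul := ?_, contMDiff_inv := ?_ }
  · refine ContMDiff.of_comp_isOpenEmbedding hφ ?_
    -- Read in the chart, multiplication is the ambient map `μ` followed by `r`, so no subspace
    -- needs to be preserved by `μ` itself.
    have h : φ ∘ (fun x : G × G => x.1 * x.2) =
        (r ∘ μ) ∘ fun x : G × G => (ι (φ x.1), ι (φ x.2)) := by
      funext x
      simp only [Function.comp_apply, ← hmul, hr _]
    rw [h]
    exact (r.contDiff.comp hμ).contMDiff.comp
      ((hj.comp contMDiff_fst).prodMk_space (hj.comp contMDiff_snd))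
  · refine ContMDiff.of_comp_isOpenEmbedding hφ ?_
    have h : φ ∘ (fun x : G => x⁻¹) = (r ∘ ν) ∘ fun x : G => ι (φ x) := by
      funext x
      simp only [Function.comp_apply, ← hinv, hr _]
    rw [h]
    intro g
    exact ContMDiffAt.comp g
      (contMDiffAt_iff_contDiffAt.2 (r.contDiff.contDiffAt.comp _ (hν g))) (hj g)

end LinearChart

/-! ### The stabiliser as an open subset of the commutant. -/

section Stabiliser

variable {𝕜 : Type u} {ℓ : ℕ} {n : Fin (ℓ + 1) → ℕ}

theorem matrixStabEntries_mem_matrixCommutant [Field 𝕜]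
    (A : ∀ i : Fin ℓ, Matrix (Fin (n i.succ)) (Fin (n i.castSucc)) 𝕜) (g : matrixStab A) :
    matrixStabEntries A g ∈ matrixCommutant A :=
  mem_matrixStab_iff.1 g.2

variable [RCLike 𝕜] (A : ∀ i : Fin ℓ, Matrix (Fin (n i.succ)) (Fin (n i.castSucc)) 𝕜)

/-- The topology on units also records the inverse. This adds nothing, because inversion is
continuous at invertible matrices by the adjugate formula. -/
theorem Matrix.isEmbedding_generalLinearGroup_val (m : ℕ) :
    Topology.IsEmbedding (Units.val : GL (Fin m) 𝕜 → Matrix (Fin m) (Fin m) 𝕜) := by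
  refine Units.isEmbedding_val_mk' (f := Inv.inv) ?_ fun u => (Matrix.coe_units_inv u).symm
  intro a ha
  have hdet : a.det ≠ 0 := ((Matrix.isUnit_iff_isUnit_det a).1 ha).ne_zero
  have h : ContinuousAt (fun b : Matrix (Fin m) (Fin m) 𝕜 => b.det⁻¹ • b.adjugate) a :=
    ((continuous_id.matrix_det.continuousAt).inv₀ hdet).smul
      continuous_id.matrix_adjugate.continuousAt
  refine ContinuousAt.continuousWithinAt ?_
  convert h using 1
  funext b
  rw [Matrix.inv_def, Ring.inverse_eq_inv']

theorem isEmbedding_matrixStabEntries : Topology.IsEmbedding (matrixStabEntries A) :=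
  (Topology.IsEmbedding.piMap fun i => Matrix.isEmbedding_generalLinearGroup_val (n i)).comp
    Topology.IsEmbedding.subtypeVal

theorem range_matrixStabEntries :
    Set.range (matrixStabEntries A) =
      {g | g ∈ matrixCommutant A ∧ ∀ i, (Matrix.of (g i)).det ≠ 0} := by
  ext g
  constructor
  · rintro ⟨g, rfl⟩
    exact ⟨matrixStabEntries_mem_matrixCommutant A g, fun i =>
      ((Matrix.isUnit_iff_isUnit_det _).1 (g.1 i).isUnit).ne_zero⟩
  · rintro ⟨hg, hdet⟩
    exact ⟨⟨fun i => Matrix.GeneralLinearGroup.mkOfDetNeZero (Matrix.of (g i)) (hdet i),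
      mem_matrixStab_iff.2 hg⟩, rfl⟩

/-- The stabiliser is open in the space of block matrices commuting with `A`. -/
theorem isOpenEmbedding_matrixStab :
    Topology.IsOpenEmbedding fun g : matrixStab A =>
      (⟨matrixStabEntries A g, matrixStabEntries_mem_matrixCommutant A g⟩ : matrixCommutant A) := by
  refine ⟨(isEmbedding_matrixStabEntries A).codRestrict _ _, ?_⟩
  have h : Set.range (fun g : matrixStab A =>
      (⟨matrixStabEntries A g, matrixStabEntries_mem_matrixCommutant A g⟩ : matrixCommutant A)) =
      {x | ∀ i, (Matrix.of (x.1 i)).det ≠ 0} := by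
    ext x
    have hx := congrArg (x.1 ∈ ·) (range_matrixStabEntries A)
    simp only [Set.mem_range, Set.mem_ofPred_eq, x.2, true_and] at hx
    simp only [Set.mem_range, Set.mem_ofPred_eq, Subtype.ext_iff, hx]
  rw [h]
  simp only [Set.ofPred_forall]
  refine isOpen_iInter_of_finite fun i => isOpen_ne_fun ?_ continuous_const
  exact Continuous.matrix_det ((continuous_apply i).comp continuous_subtype_val)

/-- The stabiliser of a sequence of matrices is an embedded Lie group whose dimension is that of
the space of commuting block matrices. -/
theorem exists_lieGroup_matrixStab {N : ℕ} (hN : Module.finrank 𝕜 (matrixCommutant A) = N) :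
    ∃ _ : ChartedSpace (EuclideanSpace 𝕜 (Fin N)) (matrixStab A),
      LieGroup 𝓘(𝕜, EuclideanSpace 𝕜 (Fin N)) ω (matrixStab A) ∧
      Manifold.IsSmoothEmbedding 𝓘(𝕜, EuclideanSpace 𝕜 (Fin N))
        𝓘(𝕜, ∀ i : Fin (ℓ + 1), Fin (n i) → Fin (n i) → 𝕜) ω (matrixStabEntries A) := by
  let W := ∀ i : Fin (ℓ + 1), Fin (n i) → Fin (n i) → 𝕜
  let e : matrixCommutant A ≃L[𝕜] EuclideanSpace 𝕜 (Fin N) :=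
    ContinuousLinearEquiv.ofFinrankEq (by rw [hN, finrank_euclideanSpace_fin])
  let ι : EuclideanSpace 𝕜 (Fin N) →L[𝕜] W :=
    (matrixCommutant A).subtypeL ∘L (e.symm : EuclideanSpace 𝕜 (Fin N) →L[𝕜] matrixCommutant A)
  have hι : Function.Injective ι := Subtype.val_injective.comp e.symm.injective
  -- Any linear left inverse will do; it is continuous because the spaces are finite-dimensional.
  obtain ⟨r, hr⟩ := LinearMap.exists_leftInverse_of_injective ι.toLinearMap
    (LinearMap.ker_eq_bot.2 hι)
  have hφ := e.toHomeomorph.isOpenEmbedding.comp (isOpenEmbedding_matrixStab A)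
  set φ := e.toHomeomorph ∘ fun g : matrixStab A =>
    (⟨matrixStabEntries A g, matrixStabEntries_mem_matrixCommutant A g⟩ : matrixCommutant A)
  have hιφ : ∀ g, ι (φ g) = matrixStabEntries A g := fun g =>
    congrArg Subtype.val (e.symm_apply_apply _)
  have hrι : Function.LeftInverse (LinearMap.toContinuousLinearMap r) ι :=
    fun y => LinearMap.congr_fun hr y
  have hentry : ∀ (i : Fin (ℓ + 1)) (a b : Fin (n i)), ContDiff 𝕜 ω fun w : W => w i a b :=
    fun i a b => contDiff_pi.1 (contDiff_pi.1 (contDiff_pi.1 contDiff_id i) a) b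
  refine ⟨hφ.singletonChartedSpace, ?_, ?_⟩
  · refine hφ.lieGroup_singleton ι (LinearMap.toContinuousLinearMap r) hrι
      (μ := fun x i a b => (Matrix.of (x.1 i) * Matrix.of (x.2 i)) a b)
      (ν := fun x i a b => (Matrix.of (x i))⁻¹ a b) ?_ ?_ ?_ ?_
    · refine contDiff_pi.2 fun i => contDiff_pi.2 fun a => contDiff_pi.2 fun b =>
        contDiff_iff_contDiffAt.2 fun x => ContDiffAt.matrix_mul ?_ ?_ a b
      · exact fun a b => ((hentry i a b).comp contDiff_fst).contDiffAt
      · exact fun a b => ((hentry i a b).comp contDiff_snd).contDiffAt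
    · intro g
      refine contDiffAt_pi.2 fun i => contDiffAt_pi.2 fun a => contDiffAt_pi.2 fun b =>
        ContDiffAt.matrix_inv ?_ ?_ a b
      · exact fun a b => (hentry i a b).contDiffAt
      · rw [hιφ]
        exact ((Matrix.isUnit_iff_isUnit_det _).1 (g.1 i).isUnit).ne_zero
    · intro g h
      simp only [hιφ]
      rfl
    · intro g
      simp only [hιφ]
      funext i a b
      exact congrFun (congrFun (Matrix.coe_units_inv (g.1 i)) a) b
  · have h := hφ.isSmoothEmbedding_singleton ι (LinearMap.toContinuousLinearMap r) hrι ω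
    simpa only [hιφ] using h

end Stabiliser

/-- Uniqueness of the barcode is not needed: every `d` with `M.IsBarcode d` computes the dimension
of the same endomorphism space. -/
theorem corollary3p5 {𝕜 : Type u} [RCLike 𝕜] {ℓ : ℕ} (M : PersistenceModule.{u, v} 𝕜 ℓ)
    {n : Fin (ℓ + 1) → ℕ} (B : ∀ i, Module.Basis (Fin (n i)) 𝕜 (M.V i)) :
    (∃ d : BarInterval ℓ → ℕ, M.IsBarcode d) ∧
    ∀ (d : BarInterval ℓ → ℕ), M.IsBarcode d →
    ∀ (N : ℕ), N = ∑ pq : BarInterval ℓ × BarInterval ℓ with pq.1.Prec pq.2, d pq.1 * d pq.2 →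
    ∃ _ : ChartedSpace (EuclideanSpace 𝕜 (Fin N)) (matrixStab (M.matrixRep B)),
      LieGroup 𝓘(𝕜, EuclideanSpace 𝕜 (Fin N)) ω (matrixStab (M.matrixRep B)) ∧
      Manifold.IsSmoothEmbedding 𝓘(𝕜, EuclideanSpace 𝕜 (Fin N))
        𝓘(𝕜, ∀ i : Fin (ℓ + 1), Fin (n i) → Fin (n i) → 𝕜) ω
        (matrixStabEntries (M.matrixRep B)) := by
  refine ⟨M.exists_isBarcode, fun d hd N hN => exists_lieGroup_matrixStab _ ?_⟩
  rw [M.finrank_matrixCommutant B, hd.finrank_homSpace_self, hN]
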